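/- For every real $C>0$ there is a constant $K>0$, depending only on $C$, such that the following holds. Let $N\ge 1$ be an integer, let $V_N=\{1,\dots,N\}$, and let $(d_1,\dots,d_N)$ be the degree sequence of at least one simple graph on $V_N$. Write $\sum_{i=1}^N d_i=2M$, and assume that 1. $d_i\ge 2$ for $i=1,\dots,N$; 2. $2M=\sum_{i=1}^N d_i\le\sum_{i=1}^N d_i^2\le CN$; 3. $\max_{1\le i\le N} d_i\le \ln N$. Let $G_N$ be chosen uniformly at random among all simple graphs on $V_N$ in which each vertex $i$ has degree $d_i$. Then for every set $S\subseteq V_N$ for which $\mathrm d(S)=\sum_{i\in S}d_i$ is even, \[ \mathbb P\bigl[\text{there are no edges of } G_N \text{ between } S \text{ and } V_N\setminus S\bigr]\;\le\; K\binom{M}{\mathrm d(S)/2}^{-1}. \] In particular, if for each $N$ a degree sequence on $V_N$ is given, with 1 and 2 for a fixed $C$ and with 3 for all sufficiently large $N$, then the probability is $O\bigl(\binom{M}{\mathrm d(S)/2}^{-1}\bigr)$ as $N\to\infty$, uniformly in $S$, with an implied constant that depends only on $C$. -/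

import Mathlib

/-- The simple graphs on the vertex set `Fin N` in which every vertex `i` has degree `d i`. -/
noncomputable def graphsWithDegrees {N : ℕ} (d : Fin N → ℕ) : Finset (SimpleGraph (Fin N)) :=
  open Classical in Finset.univ.filter (fun G => ∀ i, G.degree i = d i)

/-- The random graph with degree sequence `d`: the uniform distribution on the (nonempty) set of
simple graphs with that degree sequence. -/
noncomputable def randomGraph {N : ℕ} (d : Fin N → ℕ) (hd : (graphsWithDegrees d).Nonempty) :
    PMF (SimpleGraph (Fin N)) :=
  PMF.uniformOfFinset (graphsWithDegrees d) hd

/-- The event that there are no edges between `S` and its complement. -/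
def NoEdgesAcross {N : ℕ} (S : Finset (Fin N)) : Set (SimpleGraph (Fin N)) :=
  {G | ∀ i ∈ S, ∀ j ∉ S, ¬ G.Adj i j}

/-- The probability of an event `A` under a discrete distribution `p` on graphs
(every set of graphs is an event). -/
noncomputable def graphProb {N : ℕ} (p : PMF (SimpleGraph (Fin N)))
    (A : Set (SimpleGraph (Fin N))) : ℝ :=
  (@PMF.toMeasure _ ⊤ p).real A

/-! The proof uses the pairing model: vertex `i` carries `d i` half-edges, and a uniform perfect
matching of the n = 2M half-edges induces a multigraph. Every simple graph with degrees `d` arises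
from exactly ∏ (d i)! matchings, so the probability in question is at most P[the half-edges of S are
matched among themselves] / P[the matching is simple].

Numerator: write d(S) = 2s. By symmetry all sets of 2s half-edges are preserved with the same
probability, and a fixed matching preserves at most C(M,s) of them. Hence the probability is at most
C(M,s)/C(2M,2s), which is at most 1/C(M,s) by Vandermonde
(`card_matchings_preserving_mul_choose_le`).

Denominator: it is bounded below by a constant depending on C, through the lopsided local lemma
(`exp_mul_card_le_card_avoiding`). The bad events are that the matching contains a given loop or a
given pair of parallel edges. Re-pairing the partner of one point shows that avoiding partial
matchings disjoint from F does not push the probability of containing F above 1/(n-1) or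
1/((n-1)(n-3)). The second moment bound makes these values sum to at most C + C², and the
logarithmic degree bound makes the sum over events meeting a given one O(log N / N). This settles
large N; the finitely many small N are absorbed into K. -/

/-! ### The lopsided local lemma -/

open Classical in
/-- The outcomes in `Ω` at which none of the events `A i`, `i ∈ T`, happens. -/
noncomputable def avoiding {α ι : Type*} (Ω : Finset α) (A : ι → α → Prop) (T : Finset ι) :
    Finset α :=
  Ω.filter fun m => ∀ i ∈ T, ¬ A i m

theorem mem_avoiding {α ι : Type*} {Ω : Finset α} {A : ι → α → Prop} {T : Finset ι} {m : α} :
    m ∈ avoiding Ω A T ↔ m ∈ Ω ∧ ∀ i ∈ T, ¬ A i m := by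
  classical
  simp [avoiding]

theorem avoiding_anti {α ι : Type*} (Ω : Finset α) (A : ι → α → Prop) {T T' : Finset ι}
    (h : T ⊆ T') : avoiding Ω A T' ⊆ avoiding Ω A T := by
  intro m hm
  rw [mem_avoiding] at hm ⊢
  exact ⟨hm.1, fun i hi => hm.2 i (h hi)⟩

open Classical in
/-- The conditional form of the lopsided local lemma. -/
theorem card_filter_avoiding_le {α ι : Type*} (Ω : Finset α) (A : ι → α → Prop)
    (B : Finset ι) (p : ι → ℝ) (nbr : ι → ι → Prop) (hp : ∀ i ∈ B, 0 ≤ p i)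
    (hdep : ∀ i ∈ B, ∀ T ⊆ B, (∀ j ∈ T, ¬ nbr i j) →
      (((avoiding Ω A T).filter (A i)).card : ℝ) ≤ p i * (avoiding Ω A T).card)
    (hsum : ∀ i ∈ B, ∑ j ∈ B.filter (nbr i), p j ≤ 1 / 4) :
    ∀ (n : ℕ) (T : Finset ι), T.card ≤ n → T ⊆ B → ∀ i ∈ B,
      (((avoiding Ω A T).filter (A i)).card : ℝ) ≤ 2 * p i * (avoiding Ω A T).card := by
  intro n
  induction n with
  | zero =>
    intro T hT hTB i hi
    have : T = ∅ := by simpa using hT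
    subst this
    refine (hdep i hi ∅ (by simp) (by simp)).trans ?_
    have := hp i hi
    gcongr
    linarith
  | succ n ih =>
    intro T hT hTB i hi
    set T₁ := T.filter (nbr i) with hT₁
    set T₂ := T.filter (fun j => ¬ nbr i j) with hT₂
    have hpi := hp i hi
    have hT₂B : T₂ ⊆ B := (Finset.filter_subset _ _).trans hTB
    have h1 : (((avoiding Ω A T).filter (A i)).card : ℝ) ≤ p i * (avoiding Ω A T₂).card := by
      refine le_trans ?_ (hdep i hi T₂ hT₂B (fun j hj => (Finset.mem_filter.1 hj).2))
      exact_mod_cast Finset.card_le_card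
        (Finset.filter_subset_filter _ (avoiding_anti Ω A (Finset.filter_subset _ _)))
    -- It remains to see that also avoiding the neighbours in `T₁` keeps at least half of the
    -- outcomes. By a union bound with the induction hypothesis for `T₂`, the loss is at most a
    -- fraction 2 · 1/4.
    suffices h2 : ((avoiding Ω A T₂).card : ℝ) ≤ 2 * (avoiding Ω A T).card by nlinarith
    -- The induction hypothesis reaches `T₂` only if `T₂` is smaller than `T`; otherwise `T₂ = T`
    -- and nothing is lost.
    by_cases hne : T₁ = ∅
    · have : T₂ = T := by
        rw [hT₂, Finset.filter_eq_self]
        exact Finset.filter_eq_empty_iff.1 hne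
      rw [this]
      linarith [Nat.cast_nonneg (α := ℝ) (avoiding Ω A T).card]
    have hcard : T₂.card ≤ n := by
      obtain ⟨j, hj⟩ := Finset.nonempty_iff_ne_empty.2 hne
      have hj' := Finset.mem_filter.1 hj
      have : T₂.card < T.card :=
        Finset.card_lt_card (Finset.filter_ssubset.2 ⟨j, hj'.1, not_not.2 hj'.2⟩)
      omega
    have hcover : avoiding Ω A T₂ ⊆
        avoiding Ω A T ∪ T₁.biUnion fun j => (avoiding Ω A T₂).filter (A j) := by
      intro m hm
      by_cases h : ∃ j ∈ T₁, A j m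
      · obtain ⟨j, hj, hjm⟩ := h
        exact Finset.mem_union_right _
          (Finset.mem_biUnion.2 ⟨j, hj, Finset.mem_filter.2 ⟨hm, hjm⟩⟩)
      · push Not at h
        refine Finset.mem_union_left _ ?_
        rw [mem_avoiding] at hm ⊢
        refine ⟨hm.1, fun j hj => ?_⟩
        by_cases hn : nbr i j
        · exact h j (Finset.mem_filter.2 ⟨hj, hn⟩)
        · exact hm.2 j (Finset.mem_filter.2 ⟨hj, hn⟩)
    have h3 : ((avoiding Ω A T₂).card : ℝ) ≤ (avoiding Ω A T).card +
        ∑ j ∈ T₁, (((avoiding Ω A T₂).filter (A j)).card : ℝ) := by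
      exact_mod_cast (Finset.card_le_card hcover).trans ((Finset.card_union_le _ _).trans
        (Nat.add_le_add_left Finset.card_biUnion_le _))
    have h4 : ∑ j ∈ T₁, (((avoiding Ω A T₂).filter (A j)).card : ℝ) ≤
        (∑ j ∈ T₁, p j) * (2 * (avoiding Ω A T₂).card) := by
      rw [Finset.sum_mul]
      refine Finset.sum_le_sum fun j hj => ?_
      have := ih T₂ hcard hT₂B j (hTB (Finset.mem_filter.1 hj).1)
      linarith
    have h5 : ∑ j ∈ T₁, p j ≤ 1 / 4 := by
      refine le_trans (Finset.sum_le_sum_of_subset_of_nonneg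
        (Finset.filter_subset_filter _ hTB) ?_) (hsum i hi)
      intro j hj _
      exact hp j (Finset.mem_filter.1 hj).1
    nlinarith [Nat.cast_nonneg (α := ℝ) (avoiding Ω A T₂).card]

theorem Real.exp_neg_two_mul_le_one_sub {x : ℝ} (h0 : 0 ≤ x) (h1 : x ≤ 1 / 2) :
    Real.exp (-(2 * x)) ≤ 1 - x := by
  have h : 1 + 2 * x ≤ Real.exp (2 * x) := by linarith [Real.add_one_le_exp (2 * x)]
  rw [Real.exp_neg, inv_le_comm₀ (Real.exp_pos _) (by linarith)]
  refine le_trans ?_ h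
  rw [inv_le_iff_one_le_mul₀ (by linarith)]
  nlinarith

open Classical in
/-- The lopsided local lemma, in counting form. -/
theorem exp_mul_card_le_card_avoiding {α ι : Type*} (Ω : Finset α) (A : ι → α → Prop)
    (B : Finset ι) (p : ι → ℝ) (nbr : ι → ι → Prop) (hp : ∀ i ∈ B, 0 ≤ p i)
    (hp' : ∀ i ∈ B, p i ≤ 1 / 4)
    (hdep : ∀ i ∈ B, ∀ T ⊆ B, (∀ j ∈ T, ¬ nbr i j) →
      (((avoiding Ω A T).filter (A i)).card : ℝ) ≤ p i * (avoiding Ω A T).card)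
    (hsum : ∀ i ∈ B, ∑ j ∈ B.filter (nbr i), p j ≤ 1 / 4) :
    Real.exp (-(4 * ∑ i ∈ B, p i)) * Ω.card ≤ (avoiding Ω A B).card := by
  suffices h : ∀ T ⊆ B, Real.exp (-(4 * ∑ i ∈ T, p i)) * Ω.card ≤ (avoiding Ω A T).card from
    h B subset_rfl
  intro T
  induction T using Finset.induction_on with
  | empty =>
    intro _
    have : avoiding Ω A (∅ : Finset ι) = Ω := by ext; simp [mem_avoiding]
    simp [this]
  | insert i T hiT ih =>
    intro hTB
    have hi : i ∈ B := hTB (Finset.mem_insert_self _ _)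
    have hT : T ⊆ B := (Finset.subset_insert _ _).trans hTB
    have h1 := card_filter_avoiding_le Ω A B p nbr hp hdep hsum T.card T le_rfl hT i hi
    have h2 : avoiding Ω A (insert i T) = (avoiding Ω A T).filter fun m => ¬ A i m := by
      ext m
      simp only [mem_avoiding, Finset.mem_filter, Finset.forall_mem_insert]
      tauto
    have h3 : (((avoiding Ω A T).filter (A i)).card : ℝ) + (avoiding Ω A (insert i T)).card =
        (avoiding Ω A T).card := by
      rw [h2]
      exact_mod_cast Finset.card_filter_add_card_filter_not (s := avoiding Ω A T) (A i)
    -- Chain rule: each further event costs a factor at least 1 - 2p, and 1 - 2p ≥ exp(-4p) since p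
    -- ≤ 1/4.
    have h4 := Real.exp_neg_two_mul_le_one_sub (x := 2 * p i)
      (by linarith [hp i hi]) (by linarith [hp' i hi])
    calc Real.exp (-(4 * ∑ j ∈ insert i T, p j)) * Ω.card
        = Real.exp (-(2 * (2 * p i))) * (Real.exp (-(4 * ∑ j ∈ T, p j)) * Ω.card) := by
          rw [Finset.sum_insert hiT, ← mul_assoc, ← Real.exp_add]
          ring_nf
      _ ≤ (1 - 2 * p i) * (avoiding Ω A T).card := by
          have : (0 : ℝ) ≤ 1 - 2 * p i := by linarith [hp' i hi]
          exact mul_le_mul h4 (ih hT) (by positivity) this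
      _ ≤ (avoiding Ω A (insert i T)).card := by linarith

/-! ### Perfect matchings and switchings -/

/-- A perfect matching of `X`, given as a fixed-point-free involution. -/
def IsPerfectMatching {X : Type*} (m : X → X) : Prop :=
  (∀ x, m (m x) = x) ∧ ∀ x, m x ≠ x

open Classical in
/-- The set of perfect matchings of a finite type. -/
noncomputable def perfectMatchings (X : Type*) [Fintype X] : Finset (X → X) :=
  Finset.univ.filter IsPerfectMatching

theorem mem_perfectMatchings {X : Type*} [Fintype X] {m : X → X} :
    m ∈ perfectMatchings X ↔ IsPerfectMatching m := by
  simp [perfectMatchings]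

/-- The matching `m` transported along the permutation `g`. -/
def conjMatching {X : Type*} (g : Equiv.Perm X) (m : X → X) : X → X :=
  fun x => g (m (g.symm x))

theorem IsPerfectMatching.conj {X : Type*} {m : X → X} (hm : IsPerfectMatching m)
    (g : Equiv.Perm X) : IsPerfectMatching (conjMatching g m) := by
  refine ⟨fun x => ?_, fun x h => hm.2 (g.symm x) ?_⟩
  · simp [conjMatching, hm.1]
  · simpa [conjMatching, Equiv.eq_symm_apply] using h

theorem conjMatching_injective {X : Type*} (g : Equiv.Perm X) :
    Function.Injective (conjMatching g) := by
  intro m m' h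
  funext x
  simpa [conjMatching] using congrFun h (g x)

open Classical in
-- Switching: for each `s'` in `W`, conjugation by the transposition of `s` and `s'` injects the
-- matchings with `m r = s` into those with `m r = s'`, and these target classes are disjoint.
theorem card_mul_card_filter_apply_eq_le {X : Type*} [Fintype X] (Q : (X → X) → Prop) {r s : X}
    (hrs : r ≠ s) (W : Finset X) (hr : r ∉ W)
    (hQ : ∀ s' ∈ W, ∀ m, IsPerfectMatching m → Q m → m r = s →
      Q (conjMatching (Equiv.swap s s') m)) :
    W.card * ((perfectMatchings X).filter fun m => Q m ∧ m r = s).card ≤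
      ((perfectMatchings X).filter Q).card := by
  calc W.card * ((perfectMatchings X).filter fun m => Q m ∧ m r = s).card
      = ∑ _s' ∈ W, ((perfectMatchings X).filter fun m => Q m ∧ m r = s).card := by simp
    _ ≤ ∑ s' ∈ W, (((perfectMatchings X).filter Q).filter fun m => m r = s').card := by
        refine Finset.sum_le_sum fun s' hs' => ?_
        refine Finset.card_le_card_of_injOn (conjMatching (Equiv.swap s s')) ?_
          (conjMatching_injective _).injOn
        intro m hm
        simp only [Finset.coe_filter, Set.mem_ofPred_eq, mem_perfectMatchings,
          Finset.mem_filter] at hm ⊢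
        refine ⟨⟨hm.1.conj _, hQ s' hs' m hm.1 hm.2.1 hm.2.2⟩, ?_⟩
        have : r ≠ s' := fun h => hr (h ▸ hs')
        simp [conjMatching, Equiv.swap_apply_of_ne_of_ne hrs this, hm.2.2]
    _ ≤ ((perfectMatchings X).filter Q).card := by
        rw [← Finset.card_biUnion]
        · exact Finset.card_le_card (Finset.biUnion_subset.2 fun _ _ => Finset.filter_subset _ _)
        · intro a _ b _ hab
          rw [Function.onFun, Finset.disjoint_left]
          intro m hma hmb
          exact hab ((Finset.mem_filter.1 hma).2.symm.trans (Finset.mem_filter.1 hmb).2)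

/-- Moving the partner of `r` does not create edges that avoid `r` and its old partner. -/
theorem apply_eq_of_conjMatching_swap {X : Type*} [DecidableEq X] {m : X → X}
    (hm : IsPerfectMatching m) {r s s' u w : X} (hrs : r ≠ s) (hrs' : r ≠ s') (h : m r = s)
    (hur : u ≠ r) (hus : u ≠ s) (hwr : w ≠ r) (hws : w ≠ s)
    (hc : conjMatching (Equiv.swap s s') m u = w) : m u = w := by
  have hc' := (hm.conj (Equiv.swap s s')).1
  have hr : conjMatching (Equiv.swap s s') m r = s' := by
    simp [conjMatching, Equiv.swap_apply_of_ne_of_ne hrs hrs', h]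
  have hus' : u ≠ s' := fun hu => hwr <| by
    have := hc' r
    rw [hr] at this
    rw [← hc, hu, this]
  have hws' : w ≠ s' := fun hw => hur <| by
    have h1 := hc' u
    have h2 := hc' r
    rw [hc, hw] at h1
    rw [hr, h1] at h2
    exact h2
  simp only [conjMatching, Equiv.symm_swap, Equiv.swap_apply_of_ne_of_ne hus hus'] at hc
  rw [Equiv.swap_apply_eq_iff, Equiv.swap_apply_of_ne_of_ne hws hws'] at hc
  exact hc

/-- Partial matchings with one or two edges: `inl (p, q)` is the edge `pq`, and
`inr ((p, r), (q, s))` is the pair of edges `pq`, `rs`. -/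
abbrev SmallMatching (X : Type*) := (X × X) ⊕ ((X × X) × (X × X))

/-- The event that a matching contains a given partial matching. -/
def containsMatching {X : Type*} : SmallMatching X → (X → X) → Prop
  | .inl e, m => m e.1 = e.2
  | .inr f, m => m f.1.1 = f.2.1 ∧ m f.1.2 = f.2.2

/-- `x` is covered by a given partial matching. -/
def covers {X : Type*} : SmallMatching X → X → Prop
  | .inl e, x => e.1 = x ∨ e.2 = x
  | .inr f, x => (f.1.1 = x ∨ f.1.2 = x) ∨ (f.2.1 = x ∨ f.2.2 = x)

/-- The only edges a switching can create contain `r` or `s`, so it cannot create an `F` that covers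
neither. This is the source of the lopsided dependency. -/
theorem containsMatching_of_conjMatching_swap {X : Type*} [DecidableEq X] {m : X → X}
    (hm : IsPerfectMatching m) {r s s' : X} (hrs : r ≠ s) (hrs' : r ≠ s') (h : m r = s)
    {F : SmallMatching X} (hr : ¬ covers F r) (hs : ¬ covers F s)
    (hF : containsMatching F (conjMatching (Equiv.swap s s') m)) : containsMatching F m := by
  have key := @apply_eq_of_conjMatching_swap X _ m hm r s s'
  rcases F with e | f
  · simp only [covers, not_or] at hr hs
    exact key hrs hrs' h hr.1 hs.1 hr.2 hs.2 hF
  · simp only [covers, not_or] at hr hs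
    exact ⟨key hrs hrs' h hr.1.1 hs.1.1 hr.2.1 hs.2.1 hF.1,
      key hrs hrs' h hr.1.2 hs.1.2 hr.2.2 hs.2.2 hF.2⟩

open Classical in
theorem card_contains_edge_le {X : Type*} [Fintype X] (T : Finset (SmallMatching X)) {p q : X}
    (hpq : p ≠ q) (hT : ∀ F ∈ T, ¬ covers F p ∧ ¬ covers F q) :
    (Fintype.card X - 1) *
      ((avoiding (perfectMatchings X) containsMatching T).filter fun m => m p = q).card ≤
      (avoiding (perfectMatchings X) containsMatching T).card := by
  have := card_mul_card_filter_apply_eq_le (fun m => ∀ F ∈ T, ¬ containsMatching F m) hpq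
    (Finset.univ.erase p) (by simp) (fun s' hs' m hm hQ h F hF hc => hQ F hF
      (containsMatching_of_conjMatching_swap hm hpq (Finset.ne_of_mem_erase hs').symm h
        (hT F hF).1 (hT F hF).2 hc))
  rw [Finset.card_erase_of_mem (Finset.mem_univ _), Finset.card_univ] at this
  rw [avoiding, Finset.filter_filter]
  convert this

open Classical in
theorem card_contains_two_edges_le {X : Type*} [Fintype X] (T : Finset (SmallMatching X))
    {p q r s : X} (hrs : r ≠ s) (hps : p ≠ s) (hqs : q ≠ s)
    (hT : ∀ F ∈ T, ¬ covers F r ∧ ¬ covers F s) :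
    (Fintype.card X - 3) *
      ((avoiding (perfectMatchings X) containsMatching T).filter
        fun m => m p = q ∧ m r = s).card ≤
      ((avoiding (perfectMatchings X) containsMatching T).filter fun m => m p = q).card := by
  have := card_mul_card_filter_apply_eq_le
    (fun m => (∀ F ∈ T, ¬ containsMatching F m) ∧ m p = q) hrs
    -- The new partner must differ from `p` and `q` so that the edge `pq` survives; hence n - 3
    -- choices instead of n - 1.
    (Finset.univ \ {p, q, r}) (by simp) (by
      rintro s' hs' m hm ⟨hQ, hpq⟩ h
      simp only [Finset.mem_sdiff, Finset.mem_univ, Finset.mem_insert, Finset.mem_singleton,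
        not_or, true_and] at hs'
      refine ⟨fun F hF hc => hQ F hF
        (containsMatching_of_conjMatching_swap hm hrs (Ne.symm hs'.2.2) h
          (hT F hF).1 (hT F hF).2 hc), ?_⟩
      simp [conjMatching, Equiv.swap_apply_of_ne_of_ne hps (Ne.symm hs'.1), hpq,
        Equiv.swap_apply_of_ne_of_ne hqs (Ne.symm hs'.2.1)])
  rw [avoiding, Finset.filter_filter, Finset.filter_filter]
  simp only [← and_assoc]
  suffices hW : Fintype.card X - 3 ≤ (Finset.univ \ {p, q, r} : Finset X).card by
    refine Nat.le_trans (Nat.mul_le_mul_right _ hW) ?_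
    convert this
  have h3 : ({p, q, r} : Finset X).card ≤ 3 := Finset.card_le_three
  rw [Finset.card_sdiff_of_subset (Finset.subset_univ _), Finset.card_univ]
  omega

/-! ### Matchings that preserve a set of points -/

open Classical in
/-- The number of sets of size `2 * s` that are unions of edges of a perfect matching of a set
with `2 * M` elements is at most `M.choose s`. -/
theorem card_invariant_sets_le {X : Type*} [Fintype X] {m : X → X} (hm : IsPerfectMatching m)
    {M s : ℕ} (hM : Fintype.card X = 2 * M) :
    ((Finset.powersetCard (2 * s) (Finset.univ : Finset X)).filter
      fun Y => ∀ x, x ∈ Y → m x ∈ Y).card ≤ M.choose s := by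
  let e := Fintype.equivFin X
  -- `R` takes one end of each edge, the smaller in an arbitrary order. A union of edges is
  -- determined by its trace on `R`, which has half its size.
  let R : Finset X := Finset.univ.filter fun x => e x < e (m x)
  have hhalf : ∀ Y : Finset X, (∀ x, x ∈ Y → m x ∈ Y) → Y.card = 2 * (Y ∩ R).card := by
    intro Y hY
    have h1 : (Y.filter fun x => ¬ e x < e (m x)).card = (Y.filter fun x => e x < e (m x)).card := by
      refine Finset.card_bij' (fun x _ => m x) (fun x _ => m x) ?_ ?_
        (fun x _ => hm.1 x) (fun x _ => hm.1 x)
      · intro x hx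
        rw [Finset.mem_filter] at hx ⊢
        refine ⟨hY x hx.1, ?_⟩
        rw [hm.1]
        exact lt_of_le_of_ne (not_lt.1 hx.2) fun h => hm.2 x (e.injective h)
      · intro x hx
        rw [Finset.mem_filter] at hx ⊢
        refine ⟨hY x hx.1, ?_⟩
        rw [hm.1]
        exact not_lt.2 hx.2.le
    have h2 := Finset.card_filter_add_card_filter_not (s := Y) (fun x => e x < e (m x))
    have h3 : Y ∩ R = Y.filter fun x => e x < e (m x) := by
      ext x
      simp [R]
    rw [h3]
    omega
  have hR : R.card = M := by
    have := hhalf Finset.univ (by simp)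
    rw [Finset.card_univ, Finset.univ_inter] at this
    omega
  rw [← hR, ← Finset.card_powersetCard]
  refine Finset.card_le_card_of_injOn (fun Y => Y ∩ R) ?_ ?_
  · intro Y hY
    simp only [Finset.coe_filter, Finset.mem_powersetCard, Finset.subset_univ, true_and,
      Set.mem_ofPred_eq] at hY
    have := hhalf Y hY.2
    simp only [Finset.mem_coe, Finset.mem_powersetCard]
    exact ⟨Finset.inter_subset_right, by omega⟩
  · have key : ∀ Y Y' : Finset X, (∀ x, x ∈ Y → m x ∈ Y) → (∀ x, x ∈ Y' → m x ∈ Y') →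
        Y ∩ R = Y' ∩ R → Y ⊆ Y' := by
      intro Y Y' hY hY' h x hx
      by_cases hxR : x ∈ R
      · exact (Finset.mem_inter.1 (h ▸ Finset.mem_inter.2 ⟨hx, hxR⟩ : x ∈ Y' ∩ R)).1
      · have hmR : m x ∈ R := by
          simp only [R, Finset.mem_filter, Finset.mem_univ, true_and, not_lt] at hxR ⊢
          rw [hm.1]
          exact lt_of_le_of_ne hxR fun h => hm.2 x (e.injective h)
        have := hY' _ (Finset.mem_inter.1
          (h ▸ Finset.mem_inter.2 ⟨hY x hx, hmR⟩ : m x ∈ Y' ∩ R)).1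
        rwa [hm.1] at this
    intro Y hY Y' hY' h
    simp only [Finset.coe_filter, Set.mem_ofPred_eq] at hY hY'
    exact (key Y Y' hY.2 hY'.2 h).antisymm (key Y' Y hY'.2 hY.2 h.symm)

/-- One term of the Vandermonde sum. -/
theorem Nat.choose_sq_le_choose_two_mul (M s : ℕ) :
    M.choose s * M.choose s ≤ (2 * M).choose (2 * s) := by
  rw [two_mul M, two_mul s, Nat.add_choose_eq]
  exact Finset.single_le_sum (f := fun ij : ℕ × ℕ => M.choose ij.1 * M.choose ij.2)
    (fun _ _ => Nat.zero_le _) (a := (s, s)) (by simp)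

open Classical in
/-- A random perfect matching of `2 * M` points has no edge leaving a given set of `2 * s` points
with probability at most `1 / M.choose s`. -/
theorem card_matchings_preserving_mul_choose_le {X : Type*} [Fintype X] {M s : ℕ}
    (hM : Fintype.card X = 2 * M) (hs : s ≤ M) (Y : Finset X) (hY : Y.card = 2 * s) :
    ((perfectMatchings X).filter fun m => ∀ x, x ∈ Y → m x ∈ Y).card * M.choose s ≤
      (perfectMatchings X).card := by
  set k := ((perfectMatchings X).filter fun m => ∀ x, x ∈ Y → m x ∈ Y).card with hk
  have hsymm : ∀ Z ∈ Finset.powersetCard (2 * s) (Finset.univ : Finset X),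
      k ≤ ((perfectMatchings X).filter fun m => ∀ x, x ∈ Z → m x ∈ Z).card := by
    intro Z hZ
    have hZY : Y.card = Z.card := by rw [hY, (Finset.mem_powersetCard.1 hZ).2]
    obtain ⟨g, hg⟩ : ∃ g : Equiv.Perm X, ∀ x, g x ∈ Z ↔ x ∈ Y := by
      have e : {x // x ∈ Y} ≃ {x // x ∈ Z} := Finset.equivOfCardEq hZY
      refine ⟨e.extendSubtype, fun x => ⟨fun h => ?_, fun h => ?_⟩⟩
      · by_contra hx
        exact e.extendSubtype_not_mem x hx h
      · exact e.extendSubtype_mem x h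
    refine Finset.card_le_card_of_injOn (conjMatching g) ?_ (conjMatching_injective _).injOn
    intro m hm
    simp only [Finset.coe_filter, Set.mem_ofPred_eq, mem_perfectMatchings] at hm ⊢
    refine ⟨hm.1.conj g, fun x hx => ?_⟩
    rw [conjMatching, hg]
    refine hm.2 _ ((hg _).1 ?_)
    simpa using hx
  -- Double counting of the pairs of a matching and a set of size `2 * s` that it preserves.
  have hdouble : (2 * M).choose (2 * s) * k ≤ (perfectMatchings X).card * M.choose s := by
    calc (2 * M).choose (2 * s) * k
        = ∑ _Z ∈ Finset.powersetCard (2 * s) (Finset.univ : Finset X), k := by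
          rw [Finset.sum_const, Finset.card_powersetCard, Finset.card_univ, hM, smul_eq_mul]
      _ ≤ ∑ Z ∈ Finset.powersetCard (2 * s) (Finset.univ : Finset X),
          ((perfectMatchings X).filter fun m => ∀ x, x ∈ Z → m x ∈ Z).card :=
          Finset.sum_le_sum hsymm
      _ = ∑ m ∈ perfectMatchings X, ((Finset.powersetCard (2 * s)
          (Finset.univ : Finset X)).filter fun Z => ∀ x, x ∈ Z → m x ∈ Z).card :=
          (Finset.sum_card_bipartiteAbove_eq_sum_card_bipartiteBelow
            (fun (m : X → X) (Z : Finset X) => ∀ x, x ∈ Z → m x ∈ Z)).symm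
      _ ≤ ∑ _m ∈ perfectMatchings X, M.choose s :=
          Finset.sum_le_sum fun m hm => card_invariant_sets_le (mem_perfectMatchings.1 hm) hM
      _ = (perfectMatchings X).card * M.choose s := by simp
  refine Nat.le_of_mul_le_mul_right ?_ (Nat.choose_pos hs)
  calc k * M.choose s * M.choose s = M.choose s * M.choose s * k := by ring
    _ ≤ (2 * M).choose (2 * s) * k := Nat.mul_le_mul_right _ (Nat.choose_sq_le_choose_two_mul M s)
    _ ≤ _ := hdouble

/-! ### Simple matchings have probability bounded below -/

/-- A matching of a set of labelled points is simple if it gives a graph without loops and multiple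
edges on the labels. -/
def IsSimpleMatching {X V : Type*} (v : X → V) (m : X → X) : Prop :=
  (∀ x, v (m x) ≠ v x) ∧ ∀ x y, v x = v y → v (m x) = v (m y) → x = y

open Classical in
/-- The pairs of points that have the same label. -/
noncomputable def sameLabel {X V : Type*} [Fintype X] (v : X → V) : Finset (X × X) :=
  Finset.univ.filter fun e => v e.1 = v e.2

open Classical in
/-- The pairs of edges `pq`, `rs` that give a double edge on the labels. -/
noncomputable def doubleEdges {X V : Type*} [Fintype X] (v : X → V) : Finset ((X × X) × (X × X)) :=
  (sameLabel v ×ˢ sameLabel v).filter fun f => f.1.1 ≠ f.2.1 ∧ f.1.2 ≠ f.2.2 ∧ f.1.1 ≠ f.2.2 ∧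
    f.2.1 ≠ f.2.2

open Classical in
/-- The partial matchings that a simple matching must avoid. -/
noncomputable def forbiddenMatchings {X V : Type*} [Fintype X] (v : X → V) :
    Finset (SmallMatching X) :=
  ((sameLabel v).filter fun e => e.1 ≠ e.2).disjSum (doubleEdges v)

theorem isSimpleMatching_of_mem_avoiding {X V : Type*} [Fintype X] {v : X → V} {m : X → X}
    (h : m ∈ avoiding (perfectMatchings X) containsMatching (forbiddenMatchings v)) :
    IsSimpleMatching v m := by
  classical
  rw [mem_avoiding, mem_perfectMatchings] at h
  obtain ⟨hm, h⟩ := h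
  have h1 : ∀ x, v (m x) ≠ v x := fun x hx => h (.inl (x, m x))
    (by simp [forbiddenMatchings, sameLabel, hx, (hm.2 x).symm]) rfl
  refine ⟨h1, fun x y hxy hmxy => ?_⟩
  by_contra hne
  refine h (.inr ((x, y), (m x, m y))) ?_ ⟨rfl, rfl⟩
  simp only [forbiddenMatchings, doubleEdges, sameLabel, Finset.inr_mem_disjSum,
    Finset.mem_filter, Finset.mem_product, Finset.mem_univ, true_and]
  refine ⟨⟨hxy, hmxy⟩, (hm.2 x).symm, (hm.2 y).symm, fun h => h1 y ?_, fun h => hne ?_⟩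
  · rw [← h, hxy]
  · rw [← hm.1 x, h, hm.1]

/-- The probability that a random matching of `n` points contains a given partial matching. -/
noncomputable def containProb (n : ℝ) {X : Type*} : SmallMatching X → ℝ
  | .inl _ => 1 / (n - 1)
  | .inr _ => 1 / ((n - 1) * (n - 3))

open Classical in
-- The dependency hypothesis of the local lemma, where two partial matchings are neighbours if they
-- share a point. For two edges, the switching bounds for `pq` and then for `rs` given `pq` are
-- multiplied.
theorem card_avoiding_contains_le {X V : Type*} [Fintype X] (v : X → V)
    (hX : 4 ≤ Fintype.card X) {F : SmallMatching X} (hF : F ∈ forbiddenMatchings v)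
    (T : Finset (SmallMatching X)) (hT : ∀ G ∈ T, ¬ ∃ x, covers F x ∧ covers G x) :
    (((avoiding (perfectMatchings X) containsMatching T).filter (containsMatching F)).card : ℝ) ≤
      containProb (Fintype.card X) F *
        (avoiding (perfectMatchings X) containsMatching T).card := by
  have hX' : (4 : ℝ) ≤ Fintype.card X := by exact_mod_cast hX
  have hT' : ∀ x, covers F x → ∀ G ∈ T, ¬ covers G x := fun x hx G hG h => hT G hG ⟨x, hx, h⟩
  rcases F with ⟨p, q⟩ | ⟨⟨p, r⟩, ⟨q, s⟩⟩
  · have hpq : p ≠ q := by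
      simp only [forbiddenMatchings, Finset.inl_mem_disjSum, Finset.mem_filter] at hF
      exact hF.2
    have h1 := card_contains_edge_le T hpq fun G hG =>
      ⟨hT' p (by simp [covers]) G hG, hT' q (by simp [covers]) G hG⟩
    have h2 := (Nat.cast_le (α := ℝ)).2 h1
    rw [Nat.cast_mul, Nat.cast_sub (by omega), Nat.cast_one] at h2
    rw [containProb, one_div_mul_eq_div, le_div_iff₀ (by linarith), mul_comm]
    refine le_trans (le_of_eq ?_) h2
    congr! 4 with m
  · simp only [forbiddenMatchings, doubleEdges, Finset.inr_mem_disjSum, Finset.mem_filter] at hF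
    obtain ⟨-, hpq, hrs, hps, hqs⟩ := hF
    have h1 := card_contains_edge_le T hpq fun G hG =>
      ⟨hT' p (by simp [covers]) G hG, hT' q (by simp [covers]) G hG⟩
    have h2 := (Nat.cast_le (α := ℝ)).2 h1
    rw [Nat.cast_mul, Nat.cast_sub (by omega), Nat.cast_one] at h2
    have h3 := card_contains_two_edges_le T hrs hps hqs fun G hG =>
      ⟨hT' r (by simp [covers]) G hG, hT' s (by simp [covers]) G hG⟩
    have h4 := (Nat.cast_le (α := ℝ)).2 h3
    rw [Nat.cast_mul, Nat.cast_sub (by omega), Nat.cast_ofNat] at h4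
    have h5 : (0 : ℝ) < Fintype.card X - 1 := by linarith
    have h6 : (0 : ℝ) < Fintype.card X - 3 := by linarith
    rw [containProb, one_div_mul_eq_div, le_div_iff₀ (by positivity)]
    have h7 := (mul_le_mul_of_nonneg_left h4 h5.le).trans h2
    refine le_trans (le_of_eq ?_) h7
    rw [mul_comm, mul_assoc]
    congr!

open Classical in
/-- The pairs of points with the same label that involve the point `x`. -/
noncomputable def sameLabelAt {X V : Type*} [Fintype X] (v : X → V) (x : X) : Finset (X × X) :=
  (sameLabel v).filter fun e => e.1 = x ∨ e.2 = x

open Classical in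
theorem card_sameLabelAt_le {X V : Type*} [Fintype X] (v : X → V) (x : X) :
    (sameLabelAt v x).card ≤ 2 * (Finset.univ.filter fun y => v y = v x).card := by
  have : sameLabelAt v x ⊆
      (Finset.univ.filter fun y => v y = v x).image (fun y => (x, y)) ∪
        (Finset.univ.filter fun y => v y = v x).image fun y => (y, x) := by
    rintro ⟨a, b⟩ h
    simp only [sameLabelAt, sameLabel, Finset.mem_filter, Finset.mem_univ, true_and] at h
    simp only [Finset.mem_union, Finset.mem_image, Finset.mem_filter, Finset.mem_univ, true_and,
      Prod.mk.injEq]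
    rcases h with ⟨h, rfl | rfl⟩
    · exact Or.inl ⟨b, h.symm, rfl, rfl⟩
    · exact Or.inr ⟨a, h, rfl, rfl⟩
  refine (Finset.card_le_card this).trans ((Finset.card_union_le _ _).trans ?_)
  rw [two_mul]
  exact add_le_add Finset.card_image_le Finset.card_image_le

theorem sum_containProb_disjSum {X : Type*} (n : ℝ) (s : Finset (X × X))
    (t : Finset ((X × X) × (X × X))) :
    ∑ F ∈ s.disjSum t, containProb n F =
      s.card * (1 / (n - 1)) + t.card * (1 / ((n - 1) * (n - 3))) := by
  rw [Finset.sum_disjSum]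
  simp [containProb]

theorem containProb_nonneg {X : Type*} {n : ℝ} (hn : 4 ≤ n) (F : SmallMatching X) :
    0 ≤ containProb n F := by
  have h1 : 0 < n - 1 := by linarith
  have h3 : 0 < n - 3 := by linarith
  rcases F with _ | _ <;> simp only [containProb] <;> positivity

theorem containProb_le {X : Type*} {n : ℝ} (hn : 5 ≤ n) (F : SmallMatching X) :
    containProb n F ≤ 1 / 4 := by
  rcases F with _ | _ <;> simp only [containProb]
  · exact one_div_le_one_div_of_le (by norm_num) (by linarith)
  · exact one_div_le_one_div_of_le (by norm_num) (by nlinarith)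

open Classical in
-- A loop at `x` is one of at most `2 * L` same-label pairs. In a double edge through `x`, one of
-- the two same-label pairs involves `x` and the other is arbitrary.
theorem sum_containProb_covers_le {X V : Type*} [Fintype X] (v : X → V) {n : ℝ} (hn : 4 ≤ n)
    {L : ℕ} (hL : ∀ x, (Finset.univ.filter fun y => v y = v x).card ≤ L) (x : X) :
    ∑ F ∈ (forbiddenMatchings v).filter (fun F => covers F x), containProb n F ≤
      2 * L * (1 / (n - 1)) + 4 * L * (sameLabel v).card * (1 / ((n - 1) * (n - 3))) := by
  have hx : (sameLabelAt v x).card ≤ 2 * L :=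
    (card_sameLabelAt_le v x).trans (Nat.mul_le_mul_left _ (hL x))
  have hsub : (forbiddenMatchings v).filter (fun F => covers F x) ⊆
      (sameLabelAt v x).disjSum
        (sameLabelAt v x ×ˢ sameLabel v ∪ sameLabel v ×ˢ sameLabelAt v x) := by
    intro F hF
    rcases F with e | f
    · rw [Finset.mem_filter] at hF
      simp only [forbiddenMatchings, Finset.mem_filter, Finset.inl_mem_disjSum, covers] at hF
      simp only [Finset.inl_mem_disjSum, sameLabelAt, Finset.mem_filter]
      exact ⟨hF.1.1, hF.2⟩
    · rw [Finset.mem_filter] at hF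
      simp only [forbiddenMatchings, doubleEdges, Finset.mem_filter, Finset.inr_mem_disjSum,
        Finset.mem_product, covers] at hF
      simp only [Finset.inr_mem_disjSum, sameLabelAt, Finset.mem_filter, Finset.mem_union,
        Finset.mem_product]
      tauto
  have h1 : 0 < n - 1 := by linarith
  have h3 : 0 < n - 3 := by linarith
  refine (Finset.sum_le_sum_of_subset_of_nonneg hsub
    fun F _ _ => containProb_nonneg hn F).trans ?_
  rw [sum_containProb_disjSum]
  have hc1 : ((sameLabelAt v x).card : ℝ) ≤ 2 * L := by exact_mod_cast hx
  have hc2 : ((sameLabelAt v x ×ˢ sameLabel v ∪ sameLabel v ×ˢ sameLabelAt v x).card : ℝ) ≤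
      4 * L * (sameLabel v).card := by
    have := Finset.card_union_le (sameLabelAt v x ×ˢ sameLabel v) (sameLabel v ×ˢ sameLabelAt v x)
    rw [Finset.card_product, Finset.card_product] at this
    have h' : (sameLabelAt v x ×ˢ sameLabel v ∪ sameLabel v ×ˢ sameLabelAt v x).card ≤
        4 * L * (sameLabel v).card := by nlinarith
    exact_mod_cast h'
  gcongr

theorem exists_points_of_covers {X : Type*} (F : SmallMatching X) :
    ∃ x₁ x₂ x₃ x₄ : X, ∀ x, covers F x → x = x₁ ∨ x = x₂ ∨ x = x₃ ∨ x = x₄ := by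
  rcases F with e | f
  · refine ⟨e.1, e.2, e.1, e.2, fun x hx => ?_⟩
    simp only [covers] at hx
    tauto
  · refine ⟨f.1.1, f.1.2, f.2.1, f.2.2, fun x hx => ?_⟩
    simp only [covers] at hx
    tauto

open Classical in
/-- A random perfect matching of points with labels is simple with probability bounded below. -/
theorem exp_mul_card_perfectMatchings_le {X V : Type*} [Fintype X] (v : X → V) {n : ℝ}
    (hn : n = Fintype.card X) (hn5 : 5 ≤ n) {L : ℕ}
    (hL : ∀ x, (Finset.univ.filter fun y => v y = v x).card ≤ L)
    (hsum : 4 * (2 * L * (1 / (n - 1)) +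
      4 * L * (sameLabel v).card * (1 / ((n - 1) * (n - 3)))) ≤ 1 / 4) :
    Real.exp (-(4 * ((sameLabel v).card * (1 / (n - 1)) +
      ((sameLabel v).card : ℝ) ^ 2 * (1 / ((n - 1) * (n - 3)))))) * (perfectMatchings X).card ≤
      ((perfectMatchings X).filter (IsSimpleMatching v)).card := by
  have hX : 4 ≤ Fintype.card X := by
    have : (4 : ℝ) ≤ Fintype.card X := by linarith
    exact_mod_cast this
  have hn4 : 4 ≤ n := by linarith
  have h1 : 0 < n - 1 := by linarith
  have h3 : 0 < n - 3 := by linarith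
  have hLLL := exp_mul_card_le_card_avoiding (perfectMatchings X) containsMatching
    (forbiddenMatchings v) (containProb n) (fun F G => ∃ x, covers F x ∧ covers G x)
    (fun F _ => containProb_nonneg hn4 F) (fun F _ => containProb_le hn5 F)
    (fun F hF T _ hT => by
      rw [hn]
      convert card_avoiding_contains_le v hX hF T hT)
    (fun F _ => by
      refine le_trans ?_ hsum
      -- A partial matching covers at most four points, whence the factor 4 in `hsum`.
      obtain ⟨x₁, x₂, x₃, x₄, hx⟩ := exists_points_of_covers F
      let D : X → Finset (SmallMatching X) := fun x =>
        (forbiddenMatchings v).filter fun G => covers G x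
      have hD : ∀ x, ∑ G ∈ D x, containProb n G ≤ _ := sum_containProb_covers_le v hn4 hL
      have hsub : (forbiddenMatchings v).filter (fun G => ∃ x, covers F x ∧ covers G x) ⊆
          ((D x₁ ∪ D x₂) ∪ (D x₃ ∪ D x₄)) := by
        intro G hG
        rw [Finset.mem_filter] at hG
        obtain ⟨hG, x, hxF, hxG⟩ := hG
        simp only [D, Finset.mem_union, Finset.mem_filter]
        rcases hx x hxF with rfl | rfl | rfl | rfl <;> tauto
      have hunion : ∀ s t : Finset (SmallMatching X), ∑ G ∈ s ∪ t, containProb n G ≤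
          ∑ G ∈ s, containProb n G + ∑ G ∈ t, containProb n G := by
        intro s t
        rw [← Finset.sum_union_inter]
        exact le_add_of_nonneg_right (Finset.sum_nonneg fun G _ => containProb_nonneg hn4 G)
      have hle := Finset.sum_le_sum_of_subset_of_nonneg hsub
        fun G _ _ => containProb_nonneg hn4 G
      have e1 := hunion (D x₁ ∪ D x₂) (D x₃ ∪ D x₄)
      have e2 := hunion (D x₁) (D x₂)
      have e3 := hunion (D x₃) (D x₄)
      refine le_trans (le_trans (le_of_eq (by congr!)) hle) ?_
      linarith [hD x₁, hD x₂, hD x₃, hD x₄])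
  have hP : ∑ F ∈ forbiddenMatchings v, containProb n F ≤ (sameLabel v).card * (1 / (n - 1)) +
      ((sameLabel v).card : ℝ) ^ 2 * (1 / ((n - 1) * (n - 3))) := by
    rw [forbiddenMatchings, sum_containProb_disjSum]
    have c1 : (((sameLabel v).filter fun e => e.1 ≠ e.2).card : ℝ) ≤ (sameLabel v).card := by
      exact_mod_cast Finset.card_filter_le _ _
    have c2 : ((doubleEdges v).card : ℝ) ≤ ((sameLabel v).card : ℝ) ^ 2 := by
      rw [sq]
      exact_mod_cast (Finset.card_filter_le _ _).trans_eq (Finset.card_product _ _)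
    gcongr
  calc _ ≤ Real.exp (-(4 * ∑ F ∈ forbiddenMatchings v, containProb n F)) *
        (perfectMatchings X).card := by gcongr
    _ ≤ _ := hLLL
    _ ≤ _ := by
      refine Nat.cast_le.2 (Finset.card_le_card fun m hm => Finset.mem_filter.2
        ⟨(mem_avoiding.1 hm).1, isSimpleMatching_of_mem_avoiding hm⟩)

/-! ### The pairing model and simple graphs -/

/-- The points (half-edges) of the pairing model: vertex `i` has `d i` points. -/
abbrev HalfEdge {N : ℕ} (d : Fin N → ℕ) := Σ i : Fin N, Fin (d i)

open Classical in
/-- The matching of half-edges that is given by a graph and an order of the neighbours of each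
vertex. -/
noncomputable def matchingOfGraph {N : ℕ} {d : Fin N → ℕ} (G : SimpleGraph (Fin N))
    (β : ∀ i, Fin (d i) ≃ G.neighborSet i) (x : HalfEdge d) : HalfEdge d :=
  ⟨β x.1 x.2, (β (β x.1 x.2)).symm ⟨x.1, (β x.1 x.2).2.symm⟩⟩

theorem fst_matchingOfGraph {N : ℕ} {d : Fin N → ℕ} (G : SimpleGraph (Fin N))
    (β : ∀ i, Fin (d i) ≃ G.neighborSet i) (i : Fin N) (a : Fin (d i)) :
    (matchingOfGraph G β ⟨i, a⟩).1 = β i a := rfl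

theorem adj_fst_matchingOfGraph {N : ℕ} {d : Fin N → ℕ} (G : SimpleGraph (Fin N))
    (β : ∀ i, Fin (d i) ≃ G.neighborSet i) (x : HalfEdge d) :
    G.Adj x.1 (matchingOfGraph G β x).1 := (β x.1 x.2).2

theorem isPerfectMatching_matchingOfGraph {N : ℕ} {d : Fin N → ℕ} (G : SimpleGraph (Fin N))
    (β : ∀ i, Fin (d i) ≃ G.neighborSet i) : IsPerfectMatching (matchingOfGraph G β) := by
  refine ⟨fun x => ?_, fun x h => ?_⟩
  · obtain ⟨i, a⟩ := x
    have h1 : (matchingOfGraph G β (matchingOfGraph G β ⟨i, a⟩)).1 = i :=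
      congrArg Subtype.val ((β _).apply_symm_apply _)
    -- A half-edge is determined by its vertex and the neighbour it points to; stated for general
    -- `y` so that the vertex equality can be substituted.
    have key : ∀ y : HalfEdge d, ∀ h : y.1 = i, (β y.1 y.2 : Fin N) = β i a → y = ⟨i, a⟩ := by
      rintro ⟨j, b⟩ h hb
      obtain rfl : j = i := h
      exact congrArg (Sigma.mk j) ((β j).injective (Subtype.ext hb))
    exact key _ h1 (congrArg Subtype.val ((β _).apply_symm_apply _))
  · exact (adj_fst_matchingOfGraph G β x).ne (congrArg Sigma.fst h).symm

theorem adj_iff_matchingOfGraph {N : ℕ} {d : Fin N → ℕ} (G : SimpleGraph (Fin N))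
    (β : ∀ i, Fin (d i) ≃ G.neighborSet i) (i j : Fin N) :
    G.Adj i j ↔ ∃ a, (matchingOfGraph G β ⟨i, a⟩).1 = j := by
  constructor
  · intro h
    exact ⟨(β i).symm ⟨j, h⟩, by simp [fst_matchingOfGraph]⟩
  · rintro ⟨a, rfl⟩
    exact adj_fst_matchingOfGraph G β ⟨i, a⟩

theorem matchingOfGraph_injective {N : ℕ} {d : Fin N → ℕ} :
    Function.Injective fun p : (Σ G : SimpleGraph (Fin N), ∀ i, Fin (d i) ≃ G.neighborSet i) =>
      matchingOfGraph p.1 p.2 := by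
  rintro ⟨G, β⟩ ⟨G', β'⟩ h
  dsimp only at h
  obtain rfl : G = G' := by
    ext i j
    rw [adj_iff_matchingOfGraph G β, adj_iff_matchingOfGraph G' β', h]
  congr 1
  funext i
  ext a
  exact congrArg (fun y => (y.1 : ℕ)) (congrFun h ⟨i, a⟩)

theorem mem_graphsWithDegrees {N : ℕ} {d : Fin N → ℕ} {G : SimpleGraph (Fin N)} :
    G ∈ graphsWithDegrees d ↔ ∀ i, Nat.card (G.neighborSet i) = d i := by
  classical
  simp only [graphsWithDegrees, Finset.mem_filter, Finset.mem_univ, true_and,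
    Nat.card_eq_fintype_card, SimpleGraph.card_neighborSet_eq_degree]

open Classical in
theorem card_neighbor_orders {N : ℕ} {d : Fin N → ℕ} {G : SimpleGraph (Fin N)}
    (hG : G ∈ graphsWithDegrees d) :
    Fintype.card (∀ i, Fin (d i) ≃ G.neighborSet i) = ∏ i, (d i).factorial := by
  rw [Fintype.card_pi]
  refine Finset.prod_congr rfl fun i _ => ?_
  have h : Fintype.card (Fin (d i)) = Fintype.card (G.neighborSet i) := by
    rw [Fintype.card_fin, ← Nat.card_eq_fintype_card, mem_graphsWithDegrees.1 hG i]
  rw [Fintype.card_equiv (Fintype.equivOfCardEq h), Fintype.card_fin]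

open Classical in
-- Each graph has ∏ (d i)! families of neighbour orders, and distinct pairs of a graph and a family
-- give distinct matchings.
theorem card_filter_mul_le_card_matchings {N : ℕ} (d : Fin N → ℕ) (A : SimpleGraph (Fin N) → Prop)
    (A' : (HalfEdge d → HalfEdge d) → Prop)
    (h : ∀ G β, A G → A' (matchingOfGraph (d := d) G β)) :
    ((graphsWithDegrees d).filter A).card * ∏ i, (d i).factorial ≤
      ((perfectMatchings (HalfEdge d)).filter A').card := by
  calc ((graphsWithDegrees d).filter A).card * ∏ i, (d i).factorial
      = (((graphsWithDegrees d).filter A).sigma fun G =>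
          (Finset.univ : Finset (∀ i, Fin (d i) ≃ G.neighborSet i))).card := by
        rw [Finset.card_sigma, Finset.sum_congr rfl fun G hG => by
          rw [Finset.card_univ, card_neighbor_orders (Finset.mem_filter.1 hG).1]]
        simp
    _ ≤ _ := by
        refine Finset.card_le_card_of_injOn (fun p => matchingOfGraph p.1 p.2) ?_
          matchingOfGraph_injective.injOn
        rintro ⟨G, β⟩ hG
        simp only [Finset.coe_sigma, Set.mem_sigma_iff, Finset.mem_coe, Finset.mem_filter] at hG
        simp only [Finset.mem_coe, Finset.mem_filter, mem_perfectMatchings]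
        exact ⟨isPerfectMatching_matchingOfGraph G β, h G β hG.1.2⟩

/-- The graph given by a simple matching of half-edges. -/
def graphOfMatching {N : ℕ} {d : Fin N → ℕ} (m : HalfEdge d → HalfEdge d)
    (hm : IsPerfectMatching m) (hs : IsSimpleMatching Sigma.fst m) : SimpleGraph (Fin N) where
  Adj i j := ∃ a, (m ⟨i, a⟩).1 = j
  symm := ⟨by
    rintro i j ⟨a, rfl⟩
    exact ⟨(m ⟨i, a⟩).2, by rw [Sigma.eta, hm.1]⟩⟩
  loopless := ⟨by
    rintro i ⟨a, h⟩
    exact hs.1 ⟨i, a⟩ h⟩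

/-- The order of neighbours given by a simple matching of half-edges. -/
noncomputable def ordersOfMatching {N : ℕ} {d : Fin N → ℕ} (m : HalfEdge d → HalfEdge d)
    (hm : IsPerfectMatching m) (hs : IsSimpleMatching Sigma.fst m) (i : Fin N) :
    Fin (d i) ≃ (graphOfMatching m hm hs).neighborSet i :=
  Equiv.ofBijective (fun a => ⟨(m ⟨i, a⟩).1, a, rfl⟩) (by
    constructor
    · intro a b hab
      have := hs.2 ⟨i, a⟩ ⟨i, b⟩ rfl (congrArg Subtype.val hab)
      simpa using this
    · rintro ⟨j, a, rfl⟩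
      exact ⟨a, rfl⟩)

theorem graphOfMatching_mem {N : ℕ} {d : Fin N → ℕ} (m : HalfEdge d → HalfEdge d)
    (hm : IsPerfectMatching m) (hs : IsSimpleMatching Sigma.fst m) :
    graphOfMatching m hm hs ∈ graphsWithDegrees d := by
  rw [mem_graphsWithDegrees]
  intro i
  rw [← Nat.card_congr (ordersOfMatching m hm hs i), Nat.card_eq_fintype_card, Fintype.card_fin]

theorem matchingOfGraph_ordersOfMatching {N : ℕ} {d : Fin N → ℕ} (m : HalfEdge d → HalfEdge d)
    (hm : IsPerfectMatching m) (hs : IsSimpleMatching Sigma.fst m) :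
    matchingOfGraph (graphOfMatching m hm hs) (ordersOfMatching m hm hs) = m := by
  set m' := matchingOfGraph (graphOfMatching m hm hs) (ordersOfMatching m hm hs) with hm'
  have hfst : ∀ x, (m' x).1 = (m x).1 := fun x => rfl
  funext x
  -- In a simple matching a point is determined by its own label and that of its partner; `m' x` and
  -- `m x` agree in both.
  refine hs.2 _ _ (hfst x) ?_
  rw [← hfst, hm', (isPerfectMatching_matchingOfGraph _ _).1, hm.1]

open Classical in
theorem card_simple_matchings_le {N : ℕ} (d : Fin N → ℕ) :
    ((perfectMatchings (HalfEdge d)).filter (IsSimpleMatching Sigma.fst)).card ≤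
      (graphsWithDegrees d).card * ∏ i, (d i).factorial := by
  calc ((perfectMatchings (HalfEdge d)).filter (IsSimpleMatching Sigma.fst)).card
      ≤ ((graphsWithDegrees d).sigma fun G =>
          (Finset.univ : Finset (∀ i, Fin (d i) ≃ G.neighborSet i))).card := by
        refine Finset.card_le_card_of_surjOn (fun p => matchingOfGraph p.1 p.2) ?_
        intro m hm
        simp only [Finset.mem_coe, Finset.mem_filter, mem_perfectMatchings] at hm
        refine ⟨⟨graphOfMatching m hm.1 hm.2, ordersOfMatching m hm.1 hm.2⟩, ?_,
          matchingOfGraph_ordersOfMatching m hm.1 hm.2⟩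
        simp [graphOfMatching_mem]
    _ = (graphsWithDegrees d).card * ∏ i, (d i).factorial := by
        rw [Finset.card_sigma, Finset.sum_congr rfl fun G hG => by
          rw [Finset.card_univ, card_neighbor_orders hG]]
        simp

/-! ### Counting half-edges, and probabilities as ratios -/

theorem card_halfEdge {N : ℕ} (d : Fin N → ℕ) : Fintype.card (HalfEdge d) = ∑ i, d i := by
  simp

open Classical in
theorem card_filter_fst_eq {N : ℕ} (d : Fin N → ℕ) (i : Fin N) :
    (Finset.univ.filter fun y : HalfEdge d => y.1 = i).card = d i := by
  rw [← Fintype.card_fin (d i), ← Finset.card_univ,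
    ← Finset.card_map (Function.Embedding.sigmaMk (β := fun i => Fin (d i)) i)]
  congr 1
  ext ⟨j, b⟩
  simp only [Finset.mem_filter, Finset.mem_univ, true_and, Finset.mem_map,
    Function.Embedding.sigmaMk_apply]
  constructor
  · rintro rfl
    exact ⟨b, rfl⟩
  · rintro ⟨a, h⟩
    exact (congrArg Sigma.fst h).symm

open Classical in
theorem card_filter_fst_mem {N : ℕ} (d : Fin N → ℕ) (S : Finset (Fin N)) :
    (Finset.univ.filter fun y : HalfEdge d => y.1 ∈ S).card = ∑ i ∈ S, d i := by
  rw [Finset.card_eq_sum_card_fiberwise (f := Sigma.fst) (t := S) (by intro y; simp)]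
  refine Finset.sum_congr rfl fun i hi => ?_
  rw [← card_filter_fst_eq d i, Finset.filter_filter]
  congr 1
  ext y
  simp only [Finset.mem_filter, Finset.mem_univ, true_and, and_iff_right_iff_imp]
  rintro rfl
  exact hi

theorem card_sameLabel_halfEdge {N : ℕ} (d : Fin N → ℕ) :
    (sameLabel (Sigma.fst : HalfEdge d → Fin N)).card = ∑ i, d i ^ 2 := by
  classical
  have : sameLabel (Sigma.fst : HalfEdge d → Fin N) = Finset.univ.biUnion fun i =>
      (Finset.univ.filter fun y : HalfEdge d => y.1 = i) ×ˢ
        (Finset.univ.filter fun y : HalfEdge d => y.1 = i) := by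
    ext e
    simp [sameLabel, eq_comm]
  rw [this, Finset.card_biUnion]
  · refine Finset.sum_congr rfl fun i _ => ?_
    rw [Finset.card_product, sq]
    have := card_filter_fst_eq d i
    congr!
  · intro i _ j _ hij
    rw [Function.onFun, Finset.disjoint_left]
    intro e he he'
    simp only [Finset.mem_product, Finset.mem_filter] at he he'
    exact hij (he.1.2.symm.trans he'.1.2)

open Classical in
theorem graphProb_randomGraph {N : ℕ} (d : Fin N → ℕ) (hd : (graphsWithDegrees d).Nonempty)
    (A : Set (SimpleGraph (Fin N))) :
    graphProb (randomGraph d hd) A =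
      ((graphsWithDegrees d).filter (· ∈ A)).card / ((graphsWithDegrees d).card : ℝ) := by
  rw [graphProb, randomGraph, MeasureTheory.measureReal_def,
    @PMF.toMeasure_uniformOfFinset_apply _ _ hd A ⊤ MeasurableSpace.measurableSet_top]
  simp

theorem graphProb_le_one {N : ℕ} (d : Fin N → ℕ) (hd : (graphsWithDegrees d).Nonempty)
    (A : Set (SimpleGraph (Fin N))) : graphProb (randomGraph d hd) A ≤ 1 := by
  classical
  rw [graphProb_randomGraph]
  refine div_le_one_of_le₀ ?_ (Nat.cast_nonneg _)
  exact_mod_cast Finset.card_filter_le _ _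

/-! ### The two estimates for graphs and the main theorem -/

/-- The lower bound on the probability that the pairing model is simple, for bounded second moment
of the degrees. -/
theorem exp_mul_card_halfEdge_matchings_le {C : ℝ} {N M : ℕ} (hN : 3 ≤ N)
    (hlog : (64 + 128 * C) * Real.log N ≤ N) {d : Fin N → ℕ}
    (hM : 2 * M = ∑ i, d i) (h2 : ∀ i, 2 ≤ d i)
    (hsq : ((∑ i, d i ^ 2 : ℕ) : ℝ) ≤ C * N) (hd : ∀ i, (d i : ℝ) ≤ Real.log N) :
    Real.exp (-(4 * (C + C ^ 2))) * (perfectMatchings (HalfEdge d)).card ≤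
      ((graphsWithDegrees d).card * ∏ i, (d i).factorial : ℕ) := by
  classical
  have hN' : (3 : ℝ) ≤ N := by exact_mod_cast hN
  have hn : 2 * (N : ℝ) ≤ Fintype.card (HalfEdge d) := by
    rw [card_halfEdge]
    have : ∑ _i : Fin N, 2 ≤ ∑ i, d i := Finset.sum_le_sum fun i _ => h2 i
    simp only [Finset.sum_const, Finset.card_univ, Fintype.card_fin, smul_eq_mul] at this
    exact_mod_cast (by omega : 2 * N ≤ ∑ i, d i)
  set n : ℝ := (Fintype.card (HalfEdge d) : ℝ) with hn_def
  have hC : 0 ≤ C := by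
    have : 0 ≤ C * N := le_trans (Nat.cast_nonneg _) hsq
    by_contra h
    nlinarith
  have hlog0 : 0 ≤ Real.log N := Real.log_nonneg (by linarith)
  set q : ℝ := ((sameLabel (Sigma.fst : HalfEdge d → Fin N)).card : ℝ) with hq
  have hqC : q ≤ C * N := by rw [hq, card_sameLabel_halfEdge]; exact hsq
  have hq0 : 0 ≤ q := Nat.cast_nonneg _
  -- Minimum degree 2 gives n ≥ 2N, so n - 1 and n - 3 are at least N once N ≥ 3.
  have hA : 1 / (n - 1) ≤ 1 / (N : ℝ) := one_div_le_one_div_of_le (by linarith) (by linarith)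
  have hB : 1 / ((n - 1) * (n - 3)) ≤ 1 / ((N : ℝ) * N) :=
    one_div_le_one_div_of_le (by positivity)
      (mul_le_mul (by linarith) (by linarith) (by linarith) (by linarith))
  have hA0 : 0 ≤ 1 / (n - 1) := one_div_nonneg.2 (by linarith)
  have hB0 : 0 ≤ 1 / ((n - 1) * (n - 3)) :=
    one_div_nonneg.2 (mul_nonneg (by linarith) (by linarith))
  have hqA : q * (1 / (n - 1)) ≤ C := by
    calc q * (1 / (n - 1)) ≤ C * N * (1 / N) := by gcongr
      _ = C := by field_simp
  have hqB : q ^ 2 * (1 / ((n - 1) * (n - 3))) ≤ C ^ 2 := by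
    calc q ^ 2 * (1 / ((n - 1) * (n - 3))) ≤ (C * N) ^ 2 * (1 / (N * N)) := by gcongr
      _ = C ^ 2 := by field_simp
  have hL : ((⌊Real.log N⌋₊ : ℕ) : ℝ) ≤ Real.log N := Nat.floor_le hlog0
  have hmain := exp_mul_card_perfectMatchings_le (Sigma.fst : HalfEdge d → Fin N) hn_def
    (by linarith) (L := ⌊Real.log N⌋₊) (fun x => by
      have := card_filter_fst_eq d x.1
      refine le_trans (le_of_eq ?_) (Nat.le_floor (hd x.1))
      rw [← this]
      congr!) (by
      -- The sum is at most (8 + 16C) log N / N, which `hlog` bounds by 1/8.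
      calc 4 * (2 * (⌊Real.log N⌋₊ : ℝ) * (1 / (n - 1)) +
            4 * (⌊Real.log N⌋₊ : ℝ) * q * (1 / ((n - 1) * (n - 3))))
          ≤ 4 * (2 * Real.log N * (1 / N) + 4 * Real.log N * (C * N) * (1 / (N * N))) := by
            gcongr
        _ = (64 + 128 * C) * Real.log N / (8 * N) := by field_simp; ring
        _ ≤ 1 / 4 := by
            rw [div_le_div_iff₀ (by positivity) (by norm_num)]
            linarith)
  calc _ ≤ Real.exp (-(4 * (q * (1 / (n - 1)) + q ^ 2 * (1 / ((n - 1) * (n - 3)))))) *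
        (perfectMatchings (HalfEdge d)).card := by gcongr
    _ ≤ _ := hmain
    _ ≤ _ := by
      refine Nat.cast_le.2 (le_trans (le_of_eq ?_) (card_simple_matchings_le d))
      congr!

/-- A graph without edges across `S` yields only matchings that preserve the set of half-edges at
`S`. -/
theorem card_noEdgesAcross_mul_choose_le {N M : ℕ} (d : Fin N → ℕ) (hM : 2 * M = ∑ i, d i)
    (S : Finset (Fin N)) (hS : Even (∑ i ∈ S, d i)) [DecidablePred (· ∈ NoEdgesAcross S)] :
    ((graphsWithDegrees d).filter (· ∈ NoEdgesAcross S)).card * (∏ i, (d i).factorial) *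
      M.choose ((∑ i ∈ S, d i) / 2) ≤ (perfectMatchings (HalfEdge d)).card := by
  classical
  set s := (∑ i ∈ S, d i) / 2 with hs
  have h2s : ∑ i ∈ S, d i = 2 * s := by
    have := Nat.two_mul_div_two_of_even hS
    omega
  have hle : ∑ i ∈ S, d i ≤ ∑ i, d i := Finset.sum_le_sum_of_subset (Finset.subset_univ S)
  have h1 := card_filter_mul_le_card_matchings d (· ∈ NoEdgesAcross S)
    (fun m => ∀ x, x ∈ (Finset.univ.filter fun y : HalfEdge d => y.1 ∈ S) →
      m x ∈ Finset.univ.filter fun y : HalfEdge d => y.1 ∈ S) (by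
      intro G β hG x hx
      simp only [Finset.mem_filter, Finset.mem_univ, true_and] at hx ⊢
      by_contra h
      exact hG _ hx _ h (adj_fst_matchingOfGraph G β x))
  have h2 := card_matchings_preserving_mul_choose_le (X := HalfEdge d) (M := M) (s := s)
    (by rw [card_halfEdge, hM]) (by omega) (Finset.univ.filter fun y : HalfEdge d => y.1 ∈ S)
    (by
      rw [← h2s, ← card_filter_fst_mem d S])
  refine le_trans (Nat.mul_le_mul_right _ (le_trans (le_of_eq ?_) h1))
    (le_trans (le_of_eq ?_) h2) <;> congr!

theorem eventually_mul_log_le (a : ℝ) : ∀ᶠ N : ℕ in Filter.atTop, a * Real.log N ≤ N := by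
  have h := (Real.isLittleO_log_id_atTop.const_mul_left a).comp_tendsto
    tendsto_natCast_atTop_atTop
  filter_upwards [h.bound one_pos] with N hN
  simpa using (le_abs_self _).trans hN

theorem mainTheorem5 (C : ℝ) (hC : 0 < C) :
    ∃ K : ℝ, 0 < K ∧
      ∀ (N : ℕ), 1 ≤ N →
      ∀ (d : Fin N → ℕ) (hd : (graphsWithDegrees d).Nonempty) (M : ℕ),
        2 * M = ∑ i, d i →
        (∀ i, 2 ≤ d i) →
        ((∑ i, d i ^ 2 : ℕ) : ℝ) ≤ C * N →
        (∀ i, (d i : ℝ) ≤ Real.log N) →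
        ∀ S : Finset (Fin N), Even (∑ i ∈ S, d i) →
          graphProb (randomGraph d hd) (NoEdgesAcross S) ≤
            K * ((M.choose ((∑ i ∈ S, d i) / 2) : ℝ))⁻¹ := by
  classical
  obtain ⟨N₀, hN₀⟩ := Filter.eventually_atTop.1
    ((eventually_mul_log_le (64 + 128 * C)).and (Filter.eventually_ge_atTop 3))
  -- The first summand is the inverse of the lower bound for simplicity and serves N ≥ N₀. For N <
  -- N₀ the second suffices: the probability is at most 1, the binomial at most 2^M, and M ≤ C N₀ up
  -- to rounding.
  refine ⟨Real.exp (4 * (C + C ^ 2)) + 2 ^ ⌈C * N₀⌉₊, by positivity, ?_⟩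
  intro N hN d hd M hM h2 hsq hlog S hS
  have hle : ∑ i ∈ S, d i ≤ ∑ i, d i := Finset.sum_le_sum_of_subset (Finset.subset_univ S)
  have hchoose : (0 : ℝ) < M.choose ((∑ i ∈ S, d i) / 2) := by
    exact_mod_cast Nat.choose_pos (by omega)
  rw [← div_eq_mul_inv, le_div_iff₀ hchoose]
  rcases lt_or_ge N N₀ with hlt | hge
  · have hMle : M ≤ ⌈C * N₀⌉₊ := by
      have h1 : ∑ i, d i ≤ ∑ i, d i ^ 2 :=
        Finset.sum_le_sum fun i _ => Nat.le_self_pow two_ne_zero _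
      have h3 : ((∑ i, d i ^ 2 : ℕ) : ℝ) ≤ ⌈C * N₀⌉₊ := by
        refine hsq.trans (le_trans ?_ (Nat.le_ceil _))
        gcongr
      have h4 : ∑ i, d i ^ 2 ≤ ⌈C * N₀⌉₊ := by exact_mod_cast h3
      omega
    have h5 : (M.choose ((∑ i ∈ S, d i) / 2) : ℝ) ≤ 2 ^ ⌈C * N₀⌉₊ := by
      exact_mod_cast (Nat.choose_le_two_pow _ _).trans (Nat.pow_le_pow_right two_pos hMle)
    calc _ ≤ 1 * (2 : ℝ) ^ ⌈C * N₀⌉₊ :=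
          mul_le_mul (graphProb_le_one d hd _) h5 hchoose.le one_pos.le
      _ ≤ _ := by linarith [Real.exp_pos (4 * (C + C ^ 2))]
  · obtain ⟨hlogN, h3⟩ := hN₀ N hge
    have hup := card_noEdgesAcross_mul_choose_le d hM S hS
    have hlow := exp_mul_card_halfEdge_matchings_le h3 hlogN hM h2 hsq hlog
    rw [Real.exp_neg, inv_mul_le_iff₀ (Real.exp_pos _)] at hlow
    have hup' := ((Nat.cast_le (α := ℝ)).2 hup).trans hlow
    have hprod : (0 : ℝ) < ∏ i, ((d i).factorial : ℝ) :=
      Finset.prod_pos fun i _ => by exact_mod_cast (d i).factorial_pos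
    have hcard : (0 : ℝ) < (graphsWithDegrees d).card := by
      exact_mod_cast Finset.card_pos.2 hd
    push_cast at hup'
    rw [graphProb_randomGraph, div_mul_eq_mul_div, div_le_iff₀ hcard]
    have hmul : (((graphsWithDegrees d).filter (· ∈ NoEdgesAcross S)).card : ℝ) *
        M.choose ((∑ i ∈ S, d i) / 2) ≤ Real.exp (4 * (C + C ^ 2)) * (graphsWithDegrees d).card :=
      le_of_mul_le_mul_right (by linarith) hprod
    refine le_trans (le_trans (le_of_eq (by congr!)) hmul) ?_
    gcongr
    exact le_add_of_nonneg_right (by positivity)
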